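/- Let $D$ be a bounded domain in $\mathbb C^n$ and let $p\in\partial D$ be such that $D$ has $C^1$ boundary near $p$ (that is, near $p$ the set $D$ is $\{\rho<0\}$ for a real $C^1$ function $\rho$ with $d\rho\neq 0$). For $q\in D$ let $\delta_D(q)$ be the Euclidean distance from $q$ to $\partial D$, and for $X\in\mathbb C^n$ let $$S_D(q;X):=\sup_v\,[\mathcal L_v(q;X)]^{1/2},\qquad \mathcal L_v(q;X)=\sum_{j,k}\frac{\partial^2 v}{\partial z_j\partial\bar z_k}(q)X_j\overline{X_k},$$ be the Sibony metric, where the supremum runs over all functions $v:D\to[0,1)$ such that $v(q)=0$, $\log v$ is plurisubharmonic on $D$, and $v$ is of class $C^2$ near $q$. Let $p_q\in\partial D$ be any point with $\|q-p_q\|=\delta_D(q)$. Let $L_q$ be the complex line through $q$ and $p_q$, and let $H_{q^*}$ be the complex hyperplane through $q^*:=2p_q-q$ orthogonal to $L_q$. Set $$\delta^*_D(q):=\min\bigl(1,\ \operatorname{dist}(q^*,\overline D\cap H_{q^*})\bigr),$$ where the distance to the empty set is $+\infty$. Then there exist a constant $c>0$ and a neighbourhood $U$ of $p$ such that for every $q\in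 D\cap U$, every such choice of $p_q$, and every $X\in\mathbb C^n$, $$c\,S_D(q;X)\ \ge\ \frac{\delta^*_D(q)}{\delta_D(q)}\,\|X_q\|+\|X\|,$$ where $X_q$ is the orthogonal projection of the vector $X$ onto (the direction of) $L_q$. -/

import Mathlib

open Set Filter Topology MeasureTheory
open scoped ENNReal

noncomputable section

/-- Complex Euclidean space of dimension `n`, with the Hermitian norm. -/
abbrev CSpace (n : ℕ) : Type := EuclideanSpace ℂ (Fin n)

/-- The mean over the unit circle of a function with values in the extended reals:
mean of the positive part minus mean of the negative part. (For an upper semicontinuous function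
that is `< ⊤`, the first of the two is finite.) -/
def unitCircleMean (g : ℂ → EReal) : EReal :=
  ((ENNReal.ofReal (2 * Real.pi)⁻¹ *
      ∫⁻ t in Ioc (0 : ℝ) (2 * Real.pi), (g (Complex.exp (t * Complex.I))).toENNReal : ℝ≥0∞) : EReal)
  - ((ENNReal.ofReal (2 * Real.pi)⁻¹ *
      ∫⁻ t in Ioc (0 : ℝ) (2 * Real.pi), (-g (Complex.exp (t * Complex.I))).toENNReal : ℝ≥0∞) : EReal)

/-- `u : D → [-∞, ∞)` is plurisubharmonic on the open set `D`: it is upper semicontinuous and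
satisfies the sub-mean value inequality on every closed complex disc contained in `D`.
(The function identically `-∞` is allowed.) -/
def IsPlurisubharmonicOn {n : ℕ} (u : CSpace n → EReal) (D : Set (CSpace n)) : Prop :=
  (∀ z ∈ D, u z < ⊤) ∧
  UpperSemicontinuousOn u D ∧
  ∀ a b : CSpace n, (∀ l : ℂ, ‖l‖ ≤ 1 → a + l • b ∈ D) →
    u a ≤ unitCircleMean (fun l => u (a + l • b))

/-- The Levi form `∑ⱼₖ (∂²v/∂zⱼ∂z̄ₖ)(z) Xⱼ X̄ₖ`, which is the value at `l = 0` of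
`∂²/∂l∂l̄ v(z + l X)`, i.e. a quarter of the Laplacian at `0` of `l ↦ v(z + l X)`. -/
def leviForm {n : ℕ} (v : CSpace n → ℝ) (z X : CSpace n) : ℝ :=
  (fderiv ℝ (fderiv ℝ v) z X X
    + fderiv ℝ (fderiv ℝ v) z (Complex.I • X) (Complex.I • X)) / 4

/-- The competitors for the Sibony metric of `D` at `z`: functions `v : D → [0,1)` with `v z = 0`,
with `log v` plurisubharmonic on `D` (where `log 0 = -∞`), and of class `C²` near `z`.
Only the values of `v` on `D` matter. -/
def sibonyClass {n : ℕ} (D : Set (CSpace n)) (z : CSpace n) : Set (CSpace n → ℝ) :=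
  {v | MapsTo v D (Ico 0 1) ∧ v z = 0 ∧
    IsPlurisubharmonicOn (fun w => ENNReal.log (ENNReal.ofReal (v w))) D ∧
    ContDiffAt ℝ 2 v z}

/-- The Sibony metric `S_D(z; X)`, the supremum of `L_v(z; X)^{1/2}`, taken in `[0, ∞]`. -/
def sibonyMetric {n : ℕ} (D : Set (CSpace n)) (z X : CSpace n) : ℝ≥0∞ :=
  ⨆ v ∈ sibonyClass D z, ENNReal.ofReal (Real.sqrt (leviForm v z X))

/-- `D` has `C¹` boundary near the boundary point `p`: in an open neighbourhood `U` of `p`, the set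
`D` is `{ρ < 0}` for a real `C¹` function `ρ` without critical points. -/
def HasC1BoundaryNear {n : ℕ} (D : Set (CSpace n)) (p : CSpace n) : Prop :=
  ∃ (U : Set (CSpace n)) (ρ : CSpace n → ℝ), IsOpen U ∧ p ∈ U ∧ ContDiffOn ℝ 1 ρ U ∧
    (∀ z ∈ U, fderiv ℝ ρ z ≠ 0) ∧ D ∩ U = {z ∈ U | ρ z < 0}

/-- The distance `δ_D(q)` from `q` to the boundary of `D`. -/
def bdryDist {n : ℕ} (D : Set (CSpace n)) (q : CSpace n) : ℝ :=
  Metric.infDist q (frontier D)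

/-- The direction of the complex line `L_q` through `q` and `p_q`. -/
def normalLine {n : ℕ} (q pq : CSpace n) : Submodule ℂ (CSpace n) :=
  Submodule.span ℂ {pq - q}

/-- The reflected point `q* = 2 p_q - q`. -/
def reflectedPoint {n : ℕ} (q pq : CSpace n) : CSpace n := (2 : ℂ) • pq - q

/-- The complex hyperplane `H_{q*}` through `q*` orthogonal to `L_q`. -/
def reflectedHyperplane {n : ℕ} (q pq : CSpace n) : Set (CSpace n) :=
  {w | w - reflectedPoint q pq ∈ (normalLine q pq)ᗮ}

/-- `δ*_D(q) = min (1, dist (q*, closure D ∩ H_{q*}))`, where the distance to the empty set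
is infinite. It depends on the chosen nearest boundary point `p_q`. -/
def starDist {n : ℕ} (D : Set (CSpace n)) (q pq : CSpace n) : ℝ :=
  (min 1 (Metric.infEDist (reflectedPoint q pq)
    (closure D ∩ reflectedHyperplane q pq))).toReal

end

/-!
The competitor for the Sibony metric at `q` is `‖F‖ ^ 2` near `q`, where `F` is a small multiple of
the pair formed by `z - q` and a suitably weighted holomorphic function `f` with `f q = 0`; it is
glued by a maximum with a power `α > 2`, close to `2`, of the normalized distance to `q`. Its
logarithm is plurisubharmonic because at every point it is supported from below by a power of the
modulus of a holomorphic function, so that the maximum principle holds on every complex disc.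

For `f`, let `ξ` be the affine function equal to `1` at `q`, vanishing on `H_{q*}` and depending
only on the coordinate along `L_q`. Near a `C¹` boundary point, `D` is invariant under translation
along `q - p_q`, which increases `ξ` by positive real amounts. A point of `D` at distance less than
`δ*` from `q` with `ξ ≤ 0` could thus be moved inside `D` to a point of `H_{q*}` at distance less
than `δ*` from `q*`, which is impossible. Hence `ξ` takes values in the slit plane, and `f` is its
composition with the conformal map of the slit plane onto the disc.
-/

/-- The gluing of plurisubharmonic functions: the maximum of `h` and `g` on `U`, continued by `g`
outside `U`. It is well behaved when `h ≤ g` near the boundary of `U`. -/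
noncomputable def gluedMax {X : Type*} (U : Set X) (h g : X → ℝ) : X → ℝ :=
  open scoped Classical in U.piecewise (fun z => max (h z) (g z)) g

section gluedMax

variable {X : Type*} {U : Set X} {h g : X → ℝ} {z : X}

theorem gluedMax_of_mem (hz : z ∈ U) : gluedMax U h g z = max (h z) (g z) :=
  if_pos hz

theorem gluedMax_of_notMem (hz : z ∉ U) : gluedMax U h g z = g z :=
  if_neg hz

theorem le_gluedMax : g z ≤ gluedMax U h g z := by
  by_cases hz : z ∈ U
  · exact (le_max_right _ _).trans_eq (gluedMax_of_mem hz).symm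
  · exact (gluedMax_of_notMem hz).ge

variable [TopologicalSpace X]

theorem gluedMax_eventuallyEq_max (hU : IsOpen U) (hz : z ∈ U) :
    gluedMax U h g =ᶠ[𝓝 z] fun w => max (h w) (g w) := by
  filter_upwards [hU.mem_nhds hz] with w hw
  exact gluedMax_of_mem hw

theorem gluedMax_eventuallyEq_right (hle : ∀ᶠ w in 𝓝 z, w ∈ U → h w ≤ g w) :
    gluedMax U h g =ᶠ[𝓝 z] g := by
  filter_upwards [hle] with w hw
  by_cases hwU : w ∈ U
  · rw [gluedMax_of_mem hwU, max_eq_right (hw hwU)]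
  · exact gluedMax_of_notMem hwU

theorem gluedMax_eventuallyEq_left (hU : IsOpen U) (hz : z ∈ U) (hle : g ≤ᶠ[𝓝 z] h) :
    gluedMax U h g =ᶠ[𝓝 z] h := by
  filter_upwards [gluedMax_eventuallyEq_max hU hz, hle] with w hw hgh
  rw [hw, max_eq_left hgh]

theorem continuousAt_gluedMax (hU : IsOpen U) (hg : ContinuousAt g z)
    (hh : z ∈ U → ContinuousAt h z) (hle : z ∉ U → ∀ᶠ w in 𝓝 z, w ∈ U → h w ≤ g w) :
    ContinuousAt (gluedMax U h g) z := by
  by_cases hz : z ∈ U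
  · exact ContinuousAt.congr ((hh hz).max hg) (gluedMax_eventuallyEq_max hU hz).symm
  · exact ContinuousAt.congr hg (gluedMax_eventuallyEq_right (hle hz)).symm

end gluedMax

section HolomorphicSupport

variable {V : Type*} [NormedAddCommGroup V] [NormedSpace ℂ V]

/-- At `z`, the function `v` is supported from below by a positive power of the modulus of a
holomorphic function. A continuous function with such a support at every point has a
plurisubharmonic logarithm, and the property passes to maxima without any regularity. -/
def HasHolomorphicSupport (v : V → ℝ) (z : V) : Prop :=
  ∃ (α : ℝ) (F : V → ℂ), 0 < α ∧ (∀ᶠ w in 𝓝 z, DifferentiableAt ℂ F w) ∧ v z = ‖F z‖ ^ α ∧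
    ∀ᶠ w in 𝓝 z, ‖F w‖ ^ α ≤ v w

theorem hasHolomorphicSupport_norm_rpow {E : Type*} [NormedAddCommGroup E] [NormedSpace ℂ E]
    {F : V → E} {z : V} (hF : ∀ᶠ w in 𝓝 z, DifferentiableAt ℂ F w) {α : ℝ} (hα : 0 < α) :
    HasHolomorphicSupport (fun w => ‖F w‖ ^ α) z := by
  obtain ⟨φ, hφ, hφz⟩ := exists_dual_vector'' ℂ (F z)
  refine ⟨α, fun w => φ (F w), hα, ?_, ?_, Eventually.of_forall fun w => ?_⟩
  · filter_upwards [hF] with w hw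
    exact φ.differentiableAt.comp w hw
  · simp only [hφz, RCLike.norm_ofReal, abs_norm]
  · exact Real.rpow_le_rpow (norm_nonneg _)
      (by simpa only [one_mul] using φ.le_of_opNorm_le hφ (F w)) hα.le

namespace HasHolomorphicSupport

variable {v w : V → ℝ} {z : V}

theorem mono (hv : HasHolomorphicSupport v z) (hz : v z = w z) (hle : v ≤ᶠ[𝓝 z] w) :
    HasHolomorphicSupport w z := by
  obtain ⟨α, F, hα, hF, hFz, hFv⟩ := hv
  exact ⟨α, F, hα, hF, hz ▸ hFz, (hFv.and hle).mono fun x hx => hx.1.trans hx.2⟩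

theorem max (hv : HasHolomorphicSupport v z) (hw : HasHolomorphicSupport w z) :
    HasHolomorphicSupport (fun x => max (v x) (w x)) z := by
  rcases max_choice (v z) (w z) with h | h
  · exact hv.mono h.symm (Eventually.of_forall fun x => le_max_left _ _)
  · exact hw.mono h.symm (Eventually.of_forall fun x => le_max_right _ _)

theorem comp {V' : Type*} [NormedAddCommGroup V'] [NormedSpace ℂ V'] {g : V' → V} {z : V'}
    (hv : HasHolomorphicSupport v (g z)) (hg : ∀ᶠ w in 𝓝 z, DifferentiableAt ℂ g w) :
    HasHolomorphicSupport (v ∘ g) z := by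
  obtain ⟨α, F, hα, hF, hz, hle⟩ := hv
  have hgz : Tendsto g (𝓝 z) (𝓝 (g z)) := hg.self_of_nhds.continuousAt
  refine ⟨α, F ∘ g, hα, ?_, hz, hgz.eventually hle⟩
  filter_upwards [hgz.eventually hF, hg] with w hFw hgw
  exact hFw.comp w hgw

theorem mul_exp_re {g : V → ℂ} (hv : HasHolomorphicSupport v z)
    (hg : ∀ᶠ w in 𝓝 z, DifferentiableAt ℂ g w) :
    HasHolomorphicSupport (fun w => v w * Real.exp (g w).re) z := by
  obtain ⟨α, F, hα, hF, hz, hle⟩ := hv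
  have norm_rpow (w : V) :
      ‖Complex.exp (g w * (α : ℂ)⁻¹) * F w‖ ^ α = ‖F w‖ ^ α * Real.exp (g w).re := by
    rw [norm_mul, Real.mul_rpow (norm_nonneg _) (norm_nonneg _), Complex.norm_exp,
      ← Real.exp_mul, mul_comm, ← Complex.ofReal_inv, Complex.re_mul_ofReal,
      inv_mul_cancel_right₀ hα.ne']
  refine ⟨α, fun w => Complex.exp (g w * (α : ℂ)⁻¹) * F w, hα, ?_, ?_, ?_⟩
  · filter_upwards [hF, hg] with w hFw hgw
    exact (hgw.mul_const (α : ℂ)⁻¹).cexp.mul hFw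
  · simp only [norm_rpow, hz]
  · filter_upwards [hle] with w hw
    rw [norm_rpow]
    gcongr

theorem eventually_eq_of_isLocalMax (hv : HasHolomorphicSupport v z) (hmax : IsLocalMax v z) :
    ∀ᶠ w in 𝓝 z, v w = v z := by
  obtain ⟨α, F, hα, hF, hz, hle⟩ := hv
  have hFmax : IsLocalMax (norm ∘ F) z := by
    filter_upwards [hle, hmax] with w hFw hvw
    exact (Real.rpow_le_rpow_iff (norm_nonneg _) (norm_nonneg _) hα).1
      (hFw.trans (hvw.trans hz.le))
  filter_upwards [hle, hmax, Complex.norm_eventually_eq_of_isLocalMax hF hFmax] with w hFw hvw hFz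
  exact hvw.antisymm (by rwa [hz, ← hFz])

end HasHolomorphicSupport

theorem hasHolomorphicSupport_gluedMax {U : Set V} {h g : V → ℝ} {z : V}
    (hU : IsOpen U) (hg : HasHolomorphicSupport g z)
    (hh : z ∈ U → HasHolomorphicSupport h z) :
    HasHolomorphicSupport (gluedMax U h g) z := by
  by_cases hz : z ∈ U
  · exact ((hh hz).max hg).mono (gluedMax_of_mem hz).symm
      (gluedMax_eventuallyEq_max hU hz).symm.le
  · exact hg.mono (gluedMax_of_notMem hz).symm (Eventually.of_forall fun w => le_gluedMax)

/-- The set where `W` attains its maximum over `K` has a boundary point, near which `W` is not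
constant. -/
theorem exists_mem_frontier_le_of_hasHolomorphicSupport [Nontrivial V] {K : Set V}
    (hK : IsCompact K) {W : V → ℝ} (hW : ContinuousOn W K)
    (hs : ∀ z ∈ interior K, HasHolomorphicSupport W z) {z : V} (hz : z ∈ K) :
    ∃ w ∈ frontier K, W z ≤ W w := by
  have : NoncompactSpace V := NormedSpace.noncompactSpace ℂ V
  obtain ⟨z₀, hz₀, hmax⟩ := hK.exists_isMaxOn ⟨z, hz⟩ hW
  set S := K ∩ W ⁻¹' {W z₀}
  have hSclosed : IsClosed S := hW.preimage_isClosed_of_isClosed hK.isClosed isClosed_singleton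
  have hScompact : IsCompact S := hK.of_isClosed_subset hSclosed inter_subset_left
  have hSnonempty : S.Nonempty := ⟨z₀, hz₀, rfl⟩
  obtain ⟨w, hw⟩ := nonempty_frontier_iff.2 ⟨hSnonempty, hScompact.ne_univ⟩
  obtain ⟨hwK, hWw : W w = W z₀⟩ := hSclosed.frontier_subset hw
  refine ⟨w, ⟨subset_closure hwK, fun hwi => hw.2 ?_⟩, hWw ▸ hmax hz⟩
  have hlocal : IsLocalMax W w := by
    filter_upwards [mem_interior_iff_mem_nhds.1 hwi] with x hx
    exact hWw ▸ hmax hx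
  rw [mem_interior_iff_mem_nhds]
  filter_upwards [mem_interior_iff_mem_nhds.1 hwi,
    (hs w hwi).eventually_eq_of_isLocalMax hlocal] with x hxK hWx
  exact ⟨hxK, hWx.trans hWw⟩

theorem le_exp_re_of_forall_frontier_le [Nontrivial V] {K : Set V} (hK : IsCompact K)
    {W : V → ℝ} (hW : ContinuousOn W K) (hs : ∀ z ∈ interior K, HasHolomorphicSupport W z)
    {g : V → ℂ} (hg : Differentiable ℂ g) (hle : ∀ w ∈ frontier K, W w ≤ Real.exp (g w).re)
    {z : V} (hz : z ∈ K) : W z ≤ Real.exp (g z).re := by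
  have hexp : Continuous fun w => Real.exp (-g w).re :=
    Real.continuous_exp.comp (Complex.continuous_re.comp hg.continuous.neg)
  obtain ⟨w, hw, hmax⟩ := exists_mem_frontier_le_of_hasHolomorphicSupport hK
    (W := fun w => W w * Real.exp (-g w).re) (hW.mul hexp.continuousOn)
    (fun w hw => (hs w hw).mul_exp_re (Eventually.of_forall hg.neg)) hz
  have hone : W w * Real.exp (-g w).re ≤ 1 := by
    rw [Complex.neg_re, Real.exp_neg, ← div_eq_mul_inv, div_le_one (Real.exp_pos _)]
    exact hle w hw
  have h := hmax.trans hone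
  rwa [Complex.neg_re, Real.exp_neg, ← div_eq_mul_inv, div_le_one (Real.exp_pos _)] at h

end HolomorphicSupport

theorem exists_polynomial_of_mem_span_fourier {T : ℝ} {G : C(AddCircle T, ℂ)}
    (hG : G ∈ Submodule.span ℂ (range (fourier (T := T)))) :
    ∃ P Q : Polynomial ℂ, ∀ x : AddCircle T,
      G x = P.eval (x.toCircle : ℂ) + star (Q.eval (x.toCircle : ℂ)) := by
  induction hG using Submodule.span_induction with
  | mem G hG =>
    obtain ⟨k, rfl⟩ := hG
    obtain ⟨m, rfl | rfl⟩ := k.eq_nat_or_neg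
    · exact ⟨Polynomial.X ^ m, 0, fun x => by simp [AddCircle.toCircle_nsmul]⟩
    · exact ⟨0, Polynomial.X ^ m, fun x => by
        simp [AddCircle.toCircle_nsmul, AddCircle.toCircle_neg, ← Circle.coe_inv_eq_conj]⟩
  | zero => exact ⟨0, 0, fun x => by simp⟩
  | add G₁ G₂ _ _ ih₁ ih₂ =>
    obtain ⟨P₁, Q₁, h₁⟩ := ih₁
    obtain ⟨P₂, Q₂, h₂⟩ := ih₂
    refine ⟨P₁ + P₂, Q₁ + Q₂, fun x => ?_⟩
    simp only [ContinuousMap.add_apply, h₁, h₂, Polynomial.eval_add, star_add]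
    ring
  | smul c G _ ih =>
    obtain ⟨P, Q, h⟩ := ih
    refine ⟨Polynomial.C c * P, Polynomial.C (star c) * Q, fun x => ?_⟩
    simp only [ContinuousMap.smul_apply, h, Polynomial.eval_mul, Polynomial.eval_C, star_mul',
      star_star, smul_eq_mul]
    ring

theorem exists_polynomial_abs_re_eval_sub_lt {φ : ℂ → ℝ}
    (hφ : ContinuousOn φ (Metric.sphere 0 1)) {ε : ℝ} (hε : 0 < ε) :
    ∃ P : Polynomial ℂ, ∀ z ∈ Metric.sphere (0 : ℂ) 1, |(P.eval z).re - φ z| < ε := by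
  have : Fact ((0 : ℝ) < 1) := ⟨one_pos⟩
  have toCircle_mem (x : AddCircle (1 : ℝ)) : (x.toCircle : ℂ) ∈ Metric.sphere (0 : ℂ) 1 :=
    mem_sphere_zero_iff_norm.2 (Circle.norm_coe _)
  let Φ : C(AddCircle (1 : ℝ), ℂ) := ⟨fun x => (φ x.toCircle : ℂ), Complex.continuous_ofReal.comp
    (hφ.comp_continuous (by fun_prop) toCircle_mem)⟩
  have hΦ : Φ ∈ closure (Submodule.span ℂ (range (fourier (T := (1 : ℝ)))) : Set _) := by
    rw [← Submodule.topologicalClosure_coe, span_fourier_closure_eq_top]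
    trivial
  obtain ⟨G, hG, hΦG⟩ := Metric.mem_closure_iff.1 hΦ ε hε
  obtain ⟨P, Q, hPQ⟩ := exists_polynomial_of_mem_span_fourier hG
  refine ⟨P + Q, fun z hz => ?_⟩
  obtain ⟨x, hx⟩ := (AddCircle.homeomorphCircle (one_ne_zero (α := ℝ))).surjective ⟨z, hz⟩
  obtain rfl : (x.toCircle : ℂ) = z := by
    rw [← AddCircle.homeomorphCircle_apply one_ne_zero, hx]
  calc |((P + Q).eval (x.toCircle : ℂ)).re - φ x.toCircle|
      = |(G x - Φ x).re| := by simp [Φ, hPQ]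
    _ ≤ ‖G x - Φ x‖ := Complex.abs_re_le_norm _
    _ = dist (Φ x) (G x) := by rw [dist_comm, dist_eq_norm]
    _ < ε := (ContinuousMap.dist_apply_le_dist x).trans_lt hΦG

theorem circleAverage_re_eval_polynomial (P : Polynomial ℂ) (c : ℂ) (R : ℝ) :
    Real.circleAverage (fun z => (P.eval z).re) c R = (P.eval c).re := by
  have hmean : Real.circleAverage (fun z => P.eval z) c R = P.eval c :=
    P.differentiable.diffContOnCl.circleAverage
  rw [← hmean]
  exact Complex.reCLM.circleAverage_comp_comm P.continuous.continuousOn.circleIntegrable'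

theorem circleAverage_le_circleAverage_add {f g : ℂ → ℝ} {c : ℂ} {R ε : ℝ} (hR : 0 ≤ R)
    (hf : ContinuousOn f (Metric.sphere c R)) (hg : ContinuousOn g (Metric.sphere c R))
    (h : ∀ z ∈ Metric.sphere c R, f z ≤ g z + ε) :
    Real.circleAverage f c R ≤ Real.circleAverage g c R + ε := by
  rw [← sub_le_iff_le_add', ← Real.circleAverage_sub (hf.circleIntegrable hR)
    (hg.circleIntegrable hR)]
  refine Real.circleAverage_mono_on_of_le_circle ((hf.sub hg).circleIntegrable hR) fun z hz => ?_
  rw [abs_of_nonneg hR] at hz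
  exact sub_le_iff_le_add'.2 (h z hz)

/-- Up to `ε`, the exponent `φ` is on the circle the real part of a polynomial, for which the
maximum principle applies. -/
theorem le_exp_circleAverage {W φ : ℂ → ℝ} (hW : ContinuousOn W (Metric.closedBall 0 1))
    (hs : ∀ z ∈ Metric.ball (0 : ℂ) 1, HasHolomorphicSupport W z)
    (hφ : ContinuousOn φ (Metric.sphere 0 1))
    (hle : ∀ z ∈ Metric.sphere (0 : ℂ) 1, W z ≤ Real.exp (φ z)) :
    W 0 ≤ Real.exp (Real.circleAverage φ 0 1) := by
  have approx {ε : ℝ} (hε : 0 < ε) : W 0 ≤ Real.exp (Real.circleAverage φ 0 1 + ε + ε) := by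
    obtain ⟨P, hP⟩ := exists_polynomial_abs_re_eval_sub_lt hφ hε
    have hmax : W 0 ≤ Real.exp (P.eval 0 + ε).re := by
      refine le_exp_re_of_forall_frontier_le (isCompact_closedBall 0 1) hW
        (fun z hz => hs z (by rwa [← interior_closedBall _ one_ne_zero]))
        (P.differentiable.add_const (ε : ℂ)) (fun z hz => ?_)
        (Metric.mem_closedBall_self zero_le_one)
      rw [frontier_closedBall _ one_ne_zero] at hz
      refine (hle z hz).trans (Real.exp_le_exp.2 ?_)
      rw [Complex.add_re, Complex.ofReal_re]
      linarith [abs_lt.1 (hP z hz)]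
    have hmean : (P.eval 0).re ≤ Real.circleAverage φ 0 1 + ε := by
      rw [← circleAverage_re_eval_polynomial P 0 1]
      exact circleAverage_le_circleAverage_add zero_le_one
        (Complex.continuous_re.comp P.continuous).continuousOn hφ fun z hz => by
          linarith [abs_lt.1 (hP z hz)]
    refine hmax.trans (Real.exp_le_exp.2 ?_)
    rw [Complex.add_re, Complex.ofReal_re]
    gcongr
  have hlim : Tendsto (fun ε => Real.exp (Real.circleAverage φ 0 1 + ε + ε)) (𝓝[>] 0)
      (𝓝 (Real.exp (Real.circleAverage φ 0 1))) := by
    refine Continuous.tendsto' (by fun_prop) _ _ (by simp) |>.mono_left nhdsWithin_le_nhds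
  exact ge_of_tendsto hlim (eventually_nhdsWithin_of_forall fun ε hε => approx hε)

theorem toENNReal_neg_log_ofReal_eq_iSup (x : ℝ) :
    (-ENNReal.log (ENNReal.ofReal x)).toENNReal =
      ⨆ N : ℕ, ENNReal.ofReal (-Real.log (max x (Real.exp (-N)))) := by
  rcases le_or_gt x 0 with hx | hx
  · have truncated (N : ℕ) : -Real.log (max x (Real.exp (-N))) = N := by
      rw [max_eq_right (hx.trans (Real.exp_pos _).le), Real.log_exp, neg_neg]
    simp only [truncated, ENNReal.ofReal_of_nonpos hx, ENNReal.log_zero, EReal.neg_bot,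
      EReal.toENNReal_top, ENNReal.ofReal_natCast, ENNReal.iSup_natCast]
  · rw [ENNReal.log_ofReal_of_pos hx, ← EReal.coe_neg, EReal.real_coe_toENNReal]
    refine le_antisymm ?_ (iSup_le fun N => ?_)
    · obtain ⟨N, hN⟩ := exists_nat_ge (-Real.log x)
      have hNx : Real.exp (-N) ≤ x := (Real.le_log_iff_exp_le hx).1 (neg_le.1 hN)
      exact le_iSup_of_le N (by rw [max_eq_left hNx])
    · exact ENNReal.ofReal_le_ofReal (neg_le_neg (Real.log_le_log hx (le_max_left _ _)))

theorem log_ofReal_nonpos {x : ℝ} (hx : x ≤ 1) : ENNReal.log (ENNReal.ofReal x) ≤ 0 :=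
  ENNReal.log_le_zero_iff.2 (ENNReal.ofReal_le_one.2 hx)

theorem unitCircleMean_of_nonpos {g : ℂ → EReal} (hg : ∀ z ∈ Metric.sphere (0 : ℂ) 1, g z ≤ 0) :
    unitCircleMean g = -((ENNReal.ofReal (2 * Real.pi)⁻¹ *
      ∫⁻ t in Ioc (0 : ℝ) (2 * Real.pi), (-g (circleMap 0 1 t)).toENNReal : ℝ≥0∞) : EReal) := by
  have hexp (t : ℝ) : Complex.exp (t * Complex.I) = circleMap 0 1 t := by
    rw [circleMap, Complex.ofReal_one, one_mul, zero_add]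
  have hpos (t : ℝ) : (g (circleMap 0 1 t)).toENNReal = 0 :=
    EReal.toENNReal_of_nonpos (hg _ (circleMap_mem_sphere 0 zero_le_one t))
  simp only [unitCircleMean, hexp, hpos, lintegral_zero, mul_zero, EReal.coe_ennreal_zero, zero_sub]

theorem ofReal_neg_circleAverage {f : ℂ → ℝ} (hf : ContinuousOn f (Metric.sphere 0 1))
    (hf0 : ∀ z ∈ Metric.sphere (0 : ℂ) 1, f z ≤ 0) :
    ENNReal.ofReal (-Real.circleAverage f 0 1) = ENNReal.ofReal (2 * Real.pi)⁻¹ *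
      ∫⁻ t in Ioc (0 : ℝ) (2 * Real.pi), ENNReal.ofReal (-f (circleMap 0 1 t)) := by
  have hmem (t : ℝ) : circleMap 0 1 t ∈ Metric.sphere (0 : ℂ) 1 :=
    circleMap_mem_sphere 0 zero_le_one t
  have hcont : Continuous fun t => -f (circleMap 0 1 t) :=
    (hf.comp_continuous (continuous_circleMap 0 1) hmem).neg
  rw [← ofReal_integral_eq_lintegral_ofReal
      (hcont.integrableOn_Icc.mono_set Ioc_subset_Icc_self)
      (ae_of_all _ fun t => neg_nonneg.2 (hf0 _ (hmem t))),
    ← ENNReal.ofReal_mul (by positivity), Real.circleAverage_def,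
    intervalIntegral.integral_of_le (by positivity), integral_neg, smul_eq_mul, mul_neg]

/-- The truncations `max u (exp (-N))` have finite logarithms, and monotone convergence applies to
them. -/
theorem unitCircleMean_log_ofReal {u : ℂ → ℝ} (hu : ContinuousOn u (Metric.sphere 0 1))
    (hu1 : ∀ z ∈ Metric.sphere (0 : ℂ) 1, u z ≤ 1) :
    unitCircleMean (fun z => ENNReal.log (ENNReal.ofReal (u z))) =
      -((⨆ N : ℕ, ENNReal.ofReal (-Real.circleAverage
        (fun z => Real.log (max (u z) (Real.exp (-N)))) 0 1) : ℝ≥0∞) : EReal) := by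
  let f : ℕ → ℂ → ℝ := fun N z => Real.log (max (u z) (Real.exp (-N)))
  have max_pos (N : ℕ) (z : ℂ) : 0 < max (u z) (Real.exp (-N)) :=
    lt_max_of_lt_right (Real.exp_pos _)
  have hf (N : ℕ) : ContinuousOn (f N) (Metric.sphere 0 1) :=
    (hu.sup continuousOn_const).log fun z _ => (max_pos N z).ne'
  have hf0 (N : ℕ) (z : ℂ) (hz : z ∈ Metric.sphere (0 : ℂ) 1) : f N z ≤ 0 :=
    Real.log_nonpos (max_pos N z).le
      (max_le (hu1 z hz) (Real.exp_le_one_iff.2 (neg_nonpos.2 N.cast_nonneg)))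
  have hmono : Monotone fun N t => ENNReal.ofReal (-f N (circleMap 0 1 t)) := by
    intro N M hNM t
    have hexp : Real.exp (-M) ≤ Real.exp (-N) :=
      Real.exp_le_exp.2 (neg_le_neg (Nat.cast_le.2 hNM))
    exact ENNReal.ofReal_le_ofReal (neg_le_neg
      (Real.log_le_log (max_pos M _) (max_le_max le_rfl hexp)))
  have hmeas (N : ℕ) : Measurable fun t => ENNReal.ofReal (-f N (circleMap 0 1 t)) :=
    ((hf N).comp_continuous (continuous_circleMap 0 1)
      (circleMap_mem_sphere 0 zero_le_one)).neg.measurable.ennreal_ofReal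
  rw [unitCircleMean_of_nonpos fun z hz => log_ofReal_nonpos (hu1 z hz)]
  simp only [toENNReal_neg_log_ofReal_eq_iSup]
  rw [lintegral_iSup hmeas hmono, ENNReal.mul_iSup]
  simp only [ofReal_neg_circleAverage (hf _) (hf0 _), f]

theorem log_ofReal_le_unitCircleMean {u : ℂ → ℝ} {x : ℝ}
    (hu : ContinuousOn u (Metric.sphere 0 1)) (hu1 : ∀ z ∈ Metric.sphere (0 : ℂ) 1, u z ≤ 1)
    (hx : ∀ η > 0, x ≤ Real.exp (Real.circleAverage (fun z => Real.log (max (u z) η)) 0 1)) :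
    ENNReal.log (ENNReal.ofReal x) ≤
      unitCircleMean fun z => ENNReal.log (ENNReal.ofReal (u z)) := by
  rw [unitCircleMean_log_ofReal hu hu1, EReal.le_neg]
  rcases le_or_gt x 0 with hx0 | hx0
  · rw [ENNReal.ofReal_of_nonpos hx0, ENNReal.log_zero, EReal.neg_bot]
    exact le_top
  have hx1 : x ≤ 1 := by
    have hmax : EqOn (fun z => Real.log (max (u z) 1)) (fun _ => 0) (Metric.sphere 0 |1|) := by
      intro z hz
      simp only [max_eq_right (hu1 z (by rwa [abs_one] at hz)), Real.log_one]
    simpa [Real.circleAverage_congr_sphere hmax, Real.circleAverage_const] using hx 1 one_pos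
  rw [ENNReal.log_ofReal_of_pos hx0, ← EReal.coe_neg,
    ← max_eq_left (neg_nonneg.2 (Real.log_nonpos hx0.le hx1)), ← EReal.coe_ennreal_ofReal,
    EReal.coe_ennreal_le_coe_ennreal_iff]
  refine iSup_le fun N => ENNReal.ofReal_le_ofReal (neg_le_neg ?_)
  exact (Real.log_le_iff_le_exp hx0).2 (hx _ (Real.exp_pos _))

theorem isPlurisubharmonicOn_log_of_hasHolomorphicSupport {n : ℕ} {D : Set (CSpace n)}
    {v : CSpace n → ℝ} (hv : ContinuousOn v D) (hv1 : ∀ z ∈ D, v z ≤ 1)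
    (hs : ∀ z ∈ D, HasHolomorphicSupport v z) :
    IsPlurisubharmonicOn (fun w => ENNReal.log (ENNReal.ofReal (v w))) D := by
  refine ⟨fun z _ => ENNReal.log_lt_top_iff.2 ENNReal.ofReal_lt_top, ?_, fun a b hab => ?_⟩
  · exact (ENNReal.continuous_log.comp_continuousOn
      (ENNReal.continuous_ofReal.comp_continuousOn hv)).upperSemicontinuousOn
  let disc : ℂ → CSpace n := fun l => a + l • b
  have hdisc : Differentiable ℂ disc := by fun_prop
  have maps (l : ℂ) (hl : l ∈ Metric.closedBall (0 : ℂ) 1) : disc l ∈ D :=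
    hab l (mem_closedBall_zero_iff.1 hl)
  have hcont : ContinuousOn (v ∘ disc) (Metric.closedBall 0 1) :=
    hv.comp hdisc.continuous.continuousOn maps
  have hsphere : ContinuousOn (v ∘ disc) (Metric.sphere 0 1) :=
    hcont.mono Metric.sphere_subset_closedBall
  have hsupp (l : ℂ) (hl : l ∈ Metric.ball (0 : ℂ) 1) : HasHolomorphicSupport (v ∘ disc) l :=
    (hs _ (maps l (Metric.ball_subset_closedBall hl))).comp (Eventually.of_forall hdisc)
  have hmean := log_ofReal_le_unitCircleMean (x := (v ∘ disc) 0) hsphere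
    (fun l hl => hv1 _ (maps l (Metric.sphere_subset_closedBall hl))) fun η hη =>
      le_exp_circleAverage hcont hsupp
        ((hsphere.sup continuousOn_const).log fun l _ => (lt_max_of_lt_right hη).ne')
        fun l _ => by
          rw [Real.exp_log (lt_max_of_lt_right hη)]
          exact le_max_left _ _
  simpa only [disc, Function.comp_apply, zero_smul, add_zero] using hmean

theorem leviForm_congr {n : ℕ} {v w : CSpace n → ℝ} {q : CSpace n} (h : v =ᶠ[𝓝 q] w)
    (X : CSpace n) : leviForm v q X = leviForm w q X := by
  rw [leviForm, leviForm, h.fderiv.fderiv_eq]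

theorem fderiv_fderiv_norm_sq_apply_self {V E : Type*} [NormedAddCommGroup V] [NormedSpace ℝ V]
    [NormedAddCommGroup E] [InnerProductSpace ℝ E] {F : V → E} {q : V} (hF : ContDiffAt ℝ 2 F q)
    (hq : F q = 0) (Y : V) :
    fderiv ℝ (fderiv ℝ fun z => ‖F z‖ ^ 2) q Y Y = 2 * ‖fderiv ℝ F q Y‖ ^ 2 := by
  have hdiff : ∀ᶠ z in 𝓝 q, DifferentiableAt ℝ F z := by
    filter_upwards [hF.eventually (by simp)] with z hz
    exact hz.differentiableAt two_ne_zero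
  have hfirst : fderiv ℝ (fun z => ‖F z‖ ^ 2) =ᶠ[𝓝 q]
      fun z => (2 : ℕ) • ((innerSL ℝ (F z)) ∘L fderiv ℝ F z) := by
    filter_upwards [hdiff] with z hz
    exact hz.hasFDerivAt.norm_sq.fderiv
  have hinner : HasFDerivAt (fun z => innerSL ℝ (F z))
      ((innerSL ℝ : E →L[ℝ] _) ∘L fderiv ℝ F q) q :=
    (innerSL ℝ : E →L[ℝ] _).hasFDerivAt.comp q hdiff.self_of_nhds.hasFDerivAt
  have hF' : HasFDerivAt (fderiv ℝ F) (fderiv ℝ (fderiv ℝ F) q) q :=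
    ((hF.fderiv_right (m := 1) le_rfl).differentiableAt one_ne_zero).hasFDerivAt
  have hsecond : HasFDerivAt (fun z => (2 : ℕ) • ((innerSL ℝ (F z)) ∘L fderiv ℝ F z)) _ q :=
    (hinner.clm_comp hF').const_smul (2 : ℕ)
  rw [hfirst.fderiv_eq, hsecond.fderiv]
  simp only [hq, map_zero, ContinuousLinearMap.zero_comp, zero_add, smul_apply,
    ContinuousLinearMap.comp_apply, ContinuousLinearMap.flip_apply,
    ContinuousLinearMap.compL_apply, nsmul_eq_mul, Nat.cast_ofNat]
  exact congrArg (2 * ·) (real_inner_self_eq_norm_sq _)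

theorem leviForm_norm_sq {n : ℕ} {E : Type*} [NormedAddCommGroup E] [InnerProductSpace ℂ E]
    {F : CSpace n → E} {q : CSpace n} (hF : ContDiffAt ℂ 2 F q) (hq : F q = 0) (X : CSpace n) :
    leviForm (fun z => ‖F z‖ ^ 2) q X = ‖fderiv ℂ F q X‖ ^ 2 := by
  let : InnerProductSpace ℝ E := InnerProductSpace.complexToReal
  have hF' : fderiv ℝ F q = (fderiv ℂ F q).restrictScalars ℝ :=
    (hF.differentiableAt two_ne_zero).fderiv_restrictScalars ℝ
  simp only [leviForm, fderiv_fderiv_norm_sq_apply_self (hF.restrict_scalars ℝ) hq, hF',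
    ContinuousLinearMap.coe_restrictScalars', map_smul, norm_smul, Complex.norm_I, one_mul]
  ring

theorem contDiffAt_norm_sq_of_complex {V E : Type*} [NormedAddCommGroup V] [NormedSpace ℂ V]
    [NormedAddCommGroup E] [InnerProductSpace ℂ E] {F : V → E} {q : V} {m : WithTop ℕ∞}
    (hF : ContDiffAt ℂ m F q) : ContDiffAt ℝ m (fun z => ‖F z‖ ^ 2) q :=
  let : InnerProductSpace ℝ E := InnerProductSpace.complexToReal
  (hF.restrict_scalars ℝ).norm_sq ℝ

theorem gluedMax_mem_sibonyClass {n : ℕ} {D U : Set (CSpace n)} {q : CSpace n}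
    {h g : CSpace n → ℝ} (hD : IsOpen D) (hU : IsOpen U) (hqU : q ∈ U)
    (hg : ContinuousOn g D) (hgs : ∀ z ∈ D, HasHolomorphicSupport g z)
    (hgI : MapsTo g D (Ico 0 1))
    (hh : ContinuousOn h (D ∩ U)) (hhs : ∀ z ∈ D ∩ U, HasHolomorphicSupport h z)
    (hh1 : ∀ z ∈ D ∩ U, h z < 1)
    (houter : ∀ z ∈ D, z ∉ U → ∀ᶠ w in 𝓝 z, w ∈ D ∩ U → h w ≤ g w)
    (hinner : g ≤ᶠ[𝓝 q] h) (hq : h q = 0) (hC2 : ContDiffAt ℝ 2 h q) :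
    gluedMax U h g ∈ sibonyClass D q := by
  have hDU : IsOpen (D ∩ U) := hD.inter hU
  have heq : gluedMax U h g =ᶠ[𝓝 q] h := gluedMax_eventuallyEq_left hU hqU hinner
  have hlt (z) (hz : z ∈ D) : gluedMax U h g z < 1 := by
    by_cases hzU : z ∈ U
    · rw [gluedMax_of_mem hzU]
      exact max_lt (hh1 z ⟨hz, hzU⟩) (hgI hz).2
    · rw [gluedMax_of_notMem hzU]
      exact (hgI hz).2
  have hcont : ContinuousOn (gluedMax U h g) D := by
    intro z hz
    refine (continuousAt_gluedMax hU (hg.continuousAt (hD.mem_nhds hz))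
      (fun hzU => hh.continuousAt (hDU.mem_nhds ⟨hz, hzU⟩)) fun hzU => ?_).continuousWithinAt
    filter_upwards [houter z hz hzU, hD.mem_nhds hz] with w hw hwD hwU
    exact hw ⟨hwD, hwU⟩
  refine ⟨fun z hz => ⟨(hgI hz).1.trans le_gluedMax, hlt z hz⟩, heq.self_of_nhds.trans hq, ?_,
    hC2.congr_of_eventuallyEq heq⟩
  exact isPlurisubharmonicOn_log_of_hasHolomorphicSupport hcont (fun z hz => (hlt z hz).le)
    fun z hz => hasHolomorphicSupport_gluedMax hU (hgs z hz) fun hzU => hhs z ⟨hz, hzU⟩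

theorem exists_pos_le_rpow {x b : ℝ} (hx : 0 < x) (hb : b < 1) : ∃ ε : ℝ, 0 < ε ∧ b ≤ x ^ ε := by
  have hlim : Tendsto (fun ε : ℝ => x ^ ε) (𝓝[>] 0) (𝓝 1) :=
    ((Real.continuous_const_rpow hx.ne').tendsto' 0 1 (Real.rpow_zero x)).mono_left
      nhdsWithin_le_nhds
  exact ((eventually_mem_nhdsWithin (s := Ioi 0)).and (hlim.eventually_const_le hb)).exists

theorem hasHolomorphicSupport_norm_sub_div_rpow {V : Type*} [NormedAddCommGroup V]
    [NormedSpace ℂ V] {R α : ℝ} (hR : 0 ≤ R) (hα : 0 < α) (q z : V) :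
    HasHolomorphicSupport (fun w => (‖w - q‖ / R) ^ α) z := by
  have hnorm (w : V) : ‖w - q‖ / R = ‖((R⁻¹ : ℝ) : ℂ) • (w - q)‖ := by
    rw [norm_smul, Complex.norm_real, Real.norm_of_nonneg (inv_nonneg.2 hR), inv_mul_eq_div]
  simp only [hnorm]
  exact hasHolomorphicSupport_norm_rpow (Eventually.of_forall fun w => by fun_prop) hα

theorem exists_two_lt_rpow_le_norm_sq {V E : Type*} [SeminormedAddCommGroup V]
    [SeminormedAddCommGroup E] {F : V → E} {q : V} {R r a b : ℝ} (hR : 0 < R) (hr : 0 < r)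
    (ha : 0 < a) (hF : ∀ᶠ z in 𝓝 q, a * ‖z - q‖ ≤ ‖F z‖) (hb : b < 1) :
    ∃ α : ℝ, 2 < α ∧ (∀ᶠ z in 𝓝 q, (‖z - q‖ / R) ^ α ≤ ‖F z‖ ^ 2) ∧
      ∀ z, r ≤ ‖z - q‖ → b * (‖z - q‖ / R) ^ 2 ≤ (‖z - q‖ / R) ^ α := by
  obtain ⟨ε, hε, hbε⟩ := exists_pos_le_rpow (div_pos hr hR) hb
  set t : V → ℝ := fun z => ‖z - q‖ / R
  have ht0 (z : V) : 0 ≤ t z := by positivity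
  have rpow_add (z : V) : t z ^ (2 + ε) = t z ^ ε * t z ^ 2 := by
    rw [add_comm, Real.rpow_add_of_nonneg (ht0 z) hε.le zero_le_two, Real.rpow_two]
  refine ⟨2 + ε, lt_add_of_pos_right 2 hε, ?_, fun z hz => ?_⟩
  · have hcont : Continuous fun z => t z ^ ε :=
      Continuous.rpow_const (by fun_prop) fun z => Or.inr hε.le
    have hlim : Tendsto (fun z => t z ^ ε) (𝓝 q) (𝓝 0) :=
      hcont.tendsto' q 0 (by simp [t, Real.zero_rpow hε.ne'])
    filter_upwards [hF, hlim.eventually_le_const (show 0 < (a * R) ^ 2 by positivity)]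
      with z hz hzε
    calc t z ^ (2 + ε) ≤ (a * R) ^ 2 * t z ^ 2 := by rw [rpow_add]; gcongr
      _ = (a * ‖z - q‖) ^ 2 := by simp only [t]; field_simp
      _ ≤ ‖F z‖ ^ 2 := by gcongr
  · have hrt : (r / R) ^ ε ≤ t z ^ ε :=
      Real.rpow_le_rpow (by positivity) (div_le_div_of_nonneg_right hz hR.le) hε.le
    rw [rpow_add]
    exact mul_le_mul_of_nonneg_right (hbε.trans hrt) (sq_nonneg _)

/-- The competitor is `‖F‖ ^ 2` near `q`, glued with a power `α > 2` of the distance, which near `q`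
is negligible compared with `‖F‖ ^ 2` and which for `α` close to `2` exceeds it away from `q`. -/
theorem ofReal_norm_fderiv_le_sibonyMetric {n : ℕ} {E : Type*} [NormedAddCommGroup E]
    [InnerProductSpace ℂ E] {D : Set (CSpace n)} (hD : IsOpen D) {q : CSpace n} (hq : q ∈ D)
    {R r s : ℝ} (hR : ∀ z ∈ D, ‖z - q‖ < R) (hr : 0 < r) (hrs : r < s) {F : CSpace n → E}
    (hF : ContDiffOn ℂ 2 F (D ∩ Metric.ball q s)) (hFq : F q = 0)
    (hF1 : ∀ z ∈ D ∩ Metric.ball q s, ‖F z‖ < 1)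
    {a b : ℝ} (ha : 0 < a) (hinner : ∀ᶠ z in 𝓝 q, a * ‖z - q‖ ≤ ‖F z‖) (hb : b < 1)
    (houter : ∀ z ∈ D ∩ Metric.ball q s, r ≤ ‖z - q‖ → ‖F z‖ ^ 2 ≤ b * (‖z - q‖ / R) ^ 2)
    (X : CSpace n) : ENNReal.ofReal ‖fderiv ℂ F q X‖ ≤ sibonyMetric D q X := by
  have hR0 : 0 < R := (norm_nonneg _).trans_lt (hR q hq)
  have hqs : q ∈ Metric.ball q s := Metric.mem_ball_self (hr.trans hrs)
  have hDs : IsOpen (D ∩ Metric.ball q s) := hD.inter Metric.isOpen_ball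
  have hFq2 : ContDiffAt ℂ 2 F q := hF.contDiffAt (hDs.mem_nhds ⟨hq, hqs⟩)
  obtain ⟨α, hα, near, far⟩ := exists_two_lt_rpow_le_norm_sq hR0 hr ha hinner hb
  have hα0 : 0 < α := two_pos.trans hα
  have hpow : Continuous fun z => (‖z - q‖ / R) ^ α :=
    Continuous.rpow_const (by fun_prop) fun z => Or.inr hα0.le
  have hv : gluedMax (Metric.ball q s) (fun z => ‖F z‖ ^ 2) (fun z => (‖z - q‖ / R) ^ α) ∈
      sibonyClass D q := by
    refine gluedMax_mem_sibonyClass hD Metric.isOpen_ball hqs hpow.continuousOn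
      (fun z _ => hasHolomorphicSupport_norm_sub_div_rpow hR0.le hα0 q z)
      (fun z hz => ⟨by positivity,
        Real.rpow_lt_one (by positivity) ((div_lt_one hR0).2 (hR z hz)) hα0⟩)
      (hF.continuousOn.norm.pow 2) (fun z hz => ?_)
      (fun z hz => pow_lt_one₀ (norm_nonneg _) (hF1 z hz) two_ne_zero)
      (fun z _ hzs => ?_) near (by simp [hFq]) (contDiffAt_norm_sq_of_complex hFq2)
    · simp only [← Real.rpow_two]
      refine hasHolomorphicSupport_norm_rpow ?_ two_pos
      filter_upwards [hDs.mem_nhds hz] with w hw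
      exact (hF.differentiableOn two_ne_zero).differentiableAt (hDs.mem_nhds hw)
    · have hrz : r < dist z q := hrs.trans_le (not_lt.1 hzs)
      filter_upwards [(continuous_id.dist continuous_const).continuousAt.eventually_const_le hrz]
        with w hrw hw
      have hrw' : r ≤ ‖w - q‖ := by rwa [← dist_eq_norm]
      exact (houter w hw hrw').trans (far w hrw')
  have hlevi := (leviForm_congr (gluedMax_eventuallyEq_left Metric.isOpen_ball hqs near) X).trans
    (leviForm_norm_sq hFq2 hFq X)
  rw [← Real.sqrt_sq (norm_nonneg (fderiv ℂ F q X)), ← hlevi]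
  exact le_iSup₂_of_le _ hv le_rfl

section WeightedPair

variable {E V : Type*} [NormedAddCommGroup E] [InnerProductSpace ℂ E] [NormedAddCommGroup V]
  [InnerProductSpace ℂ V] {s t : ℝ}

/-- The map `(x, y) ↦ (s x, t y)` into the Hilbert direct sum; it turns a weighted pair of
holomorphic maps into a single map whose squared norm serves as a competitor. -/
noncomputable def weightedPair (s t : ℝ) : E × V →L[ℂ] WithLp 2 (E × V) :=
  (WithLp.prodContinuousLinearEquiv 2 ℂ E V).symm.toContinuousLinearMap ∘L
    ((s : ℂ) • ContinuousLinearMap.fst ℂ E V).prod ((t : ℂ) • ContinuousLinearMap.snd ℂ E V)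

theorem mul_norm_fst_le_norm_weightedPair (hs : 0 ≤ s) (u : E × V) :
    s * ‖u.1‖ ≤ ‖weightedPair s t u‖ := by
  calc s * ‖u.1‖ = ‖(s : ℂ) • u.1‖ := by
        rw [norm_smul, Complex.norm_real, Real.norm_of_nonneg hs]
    _ ≤ ‖weightedPair s t u‖ := WithLp.norm_fst_le E (weightedPair s t u)

theorem mul_norm_snd_le_norm_weightedPair (ht : 0 ≤ t) (u : E × V) :
    t * ‖u.2‖ ≤ ‖weightedPair s t u‖ := by
  calc t * ‖u.2‖ = ‖(t : ℂ) • u.2‖ := by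
        rw [norm_smul, Complex.norm_real, Real.norm_of_nonneg ht]
    _ ≤ ‖weightedPair s t u‖ := WithLp.norm_snd_le E (weightedPair s t u)

theorem norm_weightedPair_le (hs : 0 ≤ s) (ht : 0 ≤ t) (u : E × V) :
    ‖weightedPair s t u‖ ≤ s * ‖u.1‖ + t * ‖u.2‖ := by
  calc ‖weightedPair s t u‖
      = ‖WithLp.toLp 2 ((s : ℂ) • u.1, (0 : V)) + WithLp.toLp 2 ((0 : E), (t : ℂ) • u.2)‖ := by
        rw [← WithLp.toLp_add, Prod.mk_add_mk, add_zero, zero_add]; rfl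
    _ ≤ ‖(s : ℂ) • u.1‖ + ‖(t : ℂ) • u.2‖ := by
        simpa only [WithLp.norm_toLp_fst, WithLp.norm_toLp_snd] using norm_add_le
          (WithLp.toLp 2 ((s : ℂ) • u.1, (0 : V))) (WithLp.toLp 2 ((0 : E), (t : ℂ) • u.2))
    _ = s * ‖u.1‖ + t * ‖u.2‖ := by
        rw [norm_smul, norm_smul, Complex.norm_real, Complex.norm_real, Real.norm_of_nonneg hs,
          Real.norm_of_nonneg ht]

end WeightedPair

theorem ofReal_add_le_sibonyMetric {n : ℕ} {D : Set (CSpace n)} (hD : IsOpen D) {q : CSpace n}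
    (hq : q ∈ D) {R s : ℝ} (hR : ∀ z ∈ D, ‖z - q‖ < R) (hs : 0 < s) (hsR : s ≤ R)
    {f : CSpace n → ℂ} (hf : ContDiffOn ℂ 2 f (D ∩ Metric.ball q s)) (hfq : f q = 0)
    (hf1 : ∀ z ∈ D ∩ Metric.ball q s, ‖f z‖ ≤ 1) (X : CSpace n) :
    ENNReal.ofReal ((s * ‖fderiv ℂ f q X‖ + ‖X‖) / (8 * R)) ≤ sibonyMetric D q X := by
  have hR0 : 0 < R := hs.trans_le hsR
  have hs' : 0 ≤ s / (4 * R) := by positivity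
  have ht' : 0 < 1 / (4 * R) := by positivity
  set T : ℂ × CSpace n →L[ℂ] WithLp 2 (ℂ × CSpace n) := weightedPair (s / (4 * R)) (1 / (4 * R))
  have hfd : DifferentiableAt ℂ f q :=
    (hf.differentiableOn two_ne_zero).differentiableAt
      ((hD.inter Metric.isOpen_ball).mem_nhds ⟨hq, Metric.mem_ball_self hs⟩)
  have hT' : fderiv ℂ (fun z => T (f z, z - q)) q X = T (fderiv ℂ f q X, X) := by
    have h : HasFDerivAt (fun z => T (f z, z - q))
        (T ∘L (fderiv ℂ f q).prod (ContinuousLinearMap.id ℂ (CSpace n))) q :=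
      T.hasFDerivAt.comp q (hfd.hasFDerivAt.prodMk ((hasFDerivAt_id q).sub_const q))
    rw [h.fderiv]
    rfl
  have hTle (z : CSpace n) (hz : z ∈ D ∩ Metric.ball q s) :
      ‖T (f z, z - q)‖ ≤ (s + ‖z - q‖) / (4 * R) := by
    calc ‖T (f z, z - q)‖ ≤ s / (4 * R) * 1 + 1 / (4 * R) * ‖z - q‖ :=
          (norm_weightedPair_le hs' ht'.le _).trans (by gcongr; exact hf1 z hz)
      _ = (s + ‖z - q‖) / (4 * R) := by ring
  refine le_trans (ENNReal.ofReal_le_ofReal ?_) (ofReal_norm_fderiv_le_sibonyMetric hD hq hR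
    (half_pos hs) (half_lt_self hs) (T.contDiff.comp_contDiffOn
      (hf.prodMk (contDiff_id.sub contDiff_const).contDiffOn)) (by simp [hfq, Prod.mk_zero_zero])
    (fun z hz => (hTle z hz).trans_lt ?_) (b := (3 / 4) ^ 2) ht'
    (Eventually.of_forall fun z => mul_norm_snd_le_norm_weightedPair ht'.le (f z, z - q))
    (by norm_num) (fun z hz hsz => ?_) X)
  · have hfst := mul_norm_fst_le_norm_weightedPair (t := 1 / (4 * R)) hs' (fderiv ℂ f q X, X)
    have hsnd := mul_norm_snd_le_norm_weightedPair (s := s / (4 * R)) ht'.le (fderiv ℂ f q X, X)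
    calc (s * ‖fderiv ℂ f q X‖ + ‖X‖) / (8 * R)
        = (s / (4 * R) * ‖fderiv ℂ f q X‖ + 1 / (4 * R) * ‖X‖) / 2 := by ring
      _ ≤ ‖fderiv ℂ (fun z => T (f z, z - q)) q X‖ := by rw [hT']; linarith
  · rw [div_lt_one (by positivity)]
    linarith [hR z hz.1]
  · calc ‖T (f z, z - q)‖ ^ 2 ≤ ((s + ‖z - q‖) / (4 * R)) ^ 2 := by gcongr; exact hTle z hz
      _ ≤ (3 * ‖z - q‖ / (4 * R)) ^ 2 := by gcongr; linarith
      _ = (3 / 4) ^ 2 * (‖z - q‖ / R) ^ 2 := by ring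

section SlitCayley

variable {ξ : ℂ}

/-- The biholomorphic map of the slit plane `ℂ \ (-∞, 0]` onto the unit disc taking `1` to `0`.
It makes bounded holomorphic functions out of those with values in the slit plane. -/
noncomputable def slitCayley (ξ : ℂ) : ℂ := (ξ.sqrt - 1) / (ξ.sqrt + 1)

theorem re_sqrt_nonneg (ξ : ℂ) : 0 ≤ ξ.sqrt.re :=
  (Complex.cpow_inv_two_re ξ).ge.trans' (Real.sqrt_nonneg _)

theorem sqrt_add_one_ne_zero (ξ : ℂ) : ξ.sqrt + 1 ≠ 0 := by
  intro h
  have hre : ξ.sqrt.re + 1 = 0 := by simpa using congrArg Complex.re h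
  linarith [re_sqrt_nonneg ξ]

theorem slitCayley_one : slitCayley 1 = 0 := by simp [slitCayley]

theorem norm_slitCayley_le_one (ξ : ℂ) : ‖slitCayley ξ‖ ≤ 1 := by
  rw [slitCayley, norm_div]
  refine div_le_one_of_le₀ ?_ (norm_nonneg _)
  rw [← sq_le_sq₀ (norm_nonneg _) (norm_nonneg _), norm_sub_sq_real, norm_add_sq_real]
  have hinner : 0 ≤ inner ℝ ξ.sqrt 1 := by simpa [Complex.inner] using re_sqrt_nonneg ξ
  linarith

theorem differentiableAt_slitCayley (hξ : ξ ∈ Complex.slitPlane) :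
    DifferentiableAt ℂ slitCayley ξ :=
  ((Complex.hasDerivAt_sqrt hξ).differentiableAt.sub_const 1).div
    ((Complex.hasDerivAt_sqrt hξ).differentiableAt.add_const 1) (sqrt_add_one_ne_zero ξ)

theorem contDiffOn_slitCayley {m : WithTop ℕ∞} : ContDiffOn ℂ m slitCayley Complex.slitPlane :=
  DifferentiableOn.contDiffOn
    (fun _ hξ => (differentiableAt_slitCayley hξ).differentiableWithinAt)
    Complex.isOpen_slitPlane

theorem hasDerivAt_slitCayley_one : HasDerivAt slitCayley (1 / 4) 1 := by
  have hsqrt : HasDerivAt Complex.sqrt (1 / 2) 1 := by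
    simpa using Complex.hasDerivAt_sqrt Complex.one_mem_slitPlane
  refine ((hsqrt.sub_const 1).div (hsqrt.add_const 1) (sqrt_add_one_ne_zero 1)).congr_deriv ?_
  norm_num [Complex.sqrt_one]

end SlitCayley

section NearestBoundaryPoint

variable {E : Type*} [NormedAddCommGroup E] [NormedSpace ℝ E] {D B : Set E} {q y e : E}
  {ρ : E → ℝ}

theorem ball_infDist_frontier_subset (hq : q ∈ D) :
    Metric.ball q (Metric.infDist q (frontier D)) ⊆ D := by
  rcases (Metric.ball q (Metric.infDist q (frontier D))).eq_empty_or_nonempty with h | h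
  · simp [h]
  have hsub : Metric.ball q (Metric.infDist q (frontier D)) ⊆ interior D ∪ interior Dᶜ :=
    Metric.ball_infDist_subset_compl.trans compl_frontier_eq_union_interior.subset
  have hqb := Metric.mem_ball_self (Metric.nonempty_ball.1 h) (x := q)
  refine ((convex_ball q _).isPreconnected.subset_left_of_subset_union isOpen_interior
    isOpen_interior (disjoint_compl_right.mono interior_subset interior_subset) hsub
    ⟨q, hqb, ?_⟩).trans interior_subset
  exact (hsub hqb).resolve_right fun h => interior_subset h hq

theorem norm_mul_norm_sub_le_apply_of_isLocalMaxOn_ball {ℓ : E →L[ℝ] ℝ} (hρ : HasFDerivAt ρ ℓ y)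
    (hmax : IsLocalMaxOn ρ (Metric.ball q ‖y - q‖) y) : ‖ℓ‖ * ‖y - q‖ ≤ ℓ (y - q) := by
  rcases (norm_nonneg (y - q)).eq_or_lt with h0 | h0
  · simp [norm_eq_zero.1 h0.symm]
  have apply_le (u : E) (hu : ‖u‖ < ‖y - q‖) : ℓ u ≤ ℓ (y - q) := by
    have hseg : openSegment ℝ y (q + u) ⊆ Metric.ball q ‖y - q‖ := by
      rw [openSegment_symm, ← Metric.isOpen_ball.interior_eq]
      refine (convex_ball q _).openSegment_interior_closure_subset_interior ?_ ?_
      · rw [Metric.isOpen_ball.interior_eq]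
        simpa using hu
      · rw [closure_ball _ h0.ne', Metric.mem_closedBall, dist_eq_norm]
    have hle : ℓ (q + u - y) ≤ 0 := hmax.hasFDerivWithinAt_nonpos hρ.hasFDerivWithinAt
      (sub_mem_posTangentConeAt_of_openSegment_subset hseg)
    rw [show q + u - y = u - (y - q) by abel, map_sub] at hle
    linarith
  rw [← le_div_iff₀ h0]
  refine le_of_forall_lt fun c hc => ?_
  obtain ⟨x, hx, hcx⟩ := ℓ.exists_lt_apply_of_lt_opNorm hc
  rw [lt_div_iff₀ h0]
  have hnorm (σ : ℝ) (hσ : |σ| = 1) : ‖(σ * ‖y - q‖) • x‖ < ‖y - q‖ := by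
    rw [norm_smul, norm_mul, norm_norm, Real.norm_eq_abs, hσ, one_mul]
    exact mul_lt_of_lt_one_right h0 hx
  have hpos := apply_le _ (hnorm 1 (by simp))
  have hneg := apply_le _ (hnorm (-1) (by simp))
  simp only [map_smul, smul_eq_mul] at hpos hneg
  calc c * ‖y - q‖ < ‖ℓ x‖ * ‖y - q‖ := by gcongr
    _ ≤ ℓ (y - q) := by
      rcases abs_choice (ℓ x) with h | h <;> rw [Real.norm_eq_abs, h] <;> linarith

/-- Inside `B`, the set `D` is preserved by translation by `-m • e`, `m ≥ 0`. This is what is used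
of a `C¹` boundary, with `e` pointing outwards and `B` a small ball around a boundary point. -/
def BackwardInvariantOn (D B : Set E) (e : E) : Prop :=
  ∀ z ∈ D ∩ B, ∀ m : ℝ, 0 ≤ m → z - m • e ∈ B → z - m • e ∈ D

theorem backwardInvariantOn_of_fderiv_nonneg (hB : Convex ℝ B) (hD : ∀ z ∈ B, z ∈ D ↔ ρ z < 0)
    (hρ : ∀ z ∈ B, DifferentiableAt ℝ ρ z) (he : ∀ z ∈ B, 0 ≤ fderiv ℝ ρ z e) :
    BackwardInvariantOn D B e := by
  intro z hz m hm hzm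
  obtain ⟨w, hw, hmvt⟩ := domain_mvt (fun x hx => (hρ x hx).hasFDerivAt.hasFDerivWithinAt) hB
    hzm hz.2
  rw [sub_sub_cancel, map_smul, smul_eq_mul] at hmvt
  have hle : 0 ≤ m * fderiv ℝ ρ w e := mul_nonneg hm (he w (hB.segment_subset hzm hz.2 hw))
  have hρz : ρ z < 0 := (hD z hz.2).1 hz.1
  exact (hD _ hzm).2 (by linarith)

theorem isLocalMaxOn_of_nearest_frontier (hD : IsOpen D) (hq : q ∈ D) (hy : y ∈ frontier D)
    (hqy : ‖q - y‖ = Metric.infDist q (frontier D)) (hρ : ∀ᶠ z in 𝓝 y, z ∈ D ↔ ρ z < 0) :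
    IsLocalMaxOn ρ (Metric.ball q ‖y - q‖) y := by
  have hyD : y ∉ D := disjoint_left.1 (disjoint_frontier_iff_isOpen.2 hD) hy
  have hρy : 0 ≤ ρ y := not_lt.1 fun h => hyD (hρ.self_of_nhds.2 h)
  filter_upwards [self_mem_nhdsWithin, hρ.filter_mono nhdsWithin_le_nhds] with z hz hDz
  rw [norm_sub_rev, hqy] at hz
  exact (hDz.1 (ball_infDist_frontier_subset hq hz)).le.trans hρy

theorem eventually_prod_norm_sub_lt {X F : Type*} [TopologicalSpace X] [NormedAddCommGroup F]
    {φ : X → F} {p : X} (hφ : ContinuousAt φ p) (hp : φ p ≠ 0) :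
    ∀ᶠ x in 𝓝 p ×ˢ 𝓝 p, ‖φ x.1 - φ x.2‖ < ‖φ x.2‖ := by
  have h₁ : Tendsto (fun x : X × X => φ x.1) (𝓝 p ×ˢ 𝓝 p) (𝓝 (φ p)) := hφ.tendsto.comp tendsto_fst
  have h₂ : Tendsto (fun x : X × X => φ x.2) (𝓝 p ×ˢ 𝓝 p) (𝓝 (φ p)) := hφ.tendsto.comp tendsto_snd
  exact (h₁.sub h₂).norm.eventually_lt h₂.norm (by simpa using hp)

theorem exists_backwardInvariantOn_ball_of_contDiffAt {p : E} (hD : IsOpen D) (hp : p ∈ frontier D)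
    (hρ : ContDiffAt ℝ 1 ρ p) (hρp : fderiv ℝ ρ p ≠ 0) (hDρ : ∀ᶠ z in 𝓝 p, z ∈ D ↔ ρ z < 0) :
    ∃ r : ℝ, 0 < r ∧ ∀ q ∈ D ∩ Metric.ball p r, ∀ y ∈ frontier D,
      ‖q - y‖ = Metric.infDist q (frontier D) →
      BackwardInvariantOn D (Metric.ball p (2 * r)) (y - q) := by
  have hosc := eventually_prod_norm_sub_lt (hρ.fderiv_right (m := 0) le_rfl).continuousAt hρp
  obtain ⟨t, ht, hosc⟩ := eventually_prod_self_iff'.1 hosc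
  obtain ⟨R, hR, hball⟩ := Metric.eventually_nhds_iff_ball.1
    ((eventually_mem_set.2 ht).and (hDρ.and (hρ.eventually (by simp))))
  refine ⟨R / 2, half_pos hR, fun q hq y hy hqy => ?_⟩
  rw [mul_div_cancel₀ R two_ne_zero]
  have hyR : y ∈ Metric.ball p R := by
    have hqp : dist q p < R / 2 := hq.2
    calc dist y p ≤ dist y q + dist q p := dist_triangle y q p
      _ = Metric.infDist q (frontier D) + dist q p := by rw [dist_comm, dist_eq_norm, hqy]
      _ ≤ dist q p + dist q p := by gcongr; exact Metric.infDist_le_dist_of_mem hp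
      _ < R := by linarith
  have hmax := isLocalMaxOn_of_nearest_frontier hD hq.1 hy hqy
    (by filter_upwards [Metric.isOpen_ball.mem_nhds hyR] with z hz using (hball z hz).2.1)
  have hdiff (z : E) (hz : z ∈ Metric.ball p R) : DifferentiableAt ℝ ρ z :=
    (hball z hz).2.2.differentiableAt one_ne_zero
  have hgrad := norm_mul_norm_sub_le_apply_of_isLocalMaxOn_ball (hdiff y hyR).hasFDerivAt hmax
  refine backwardInvariantOn_of_fderiv_nonneg (convex_ball p R) (fun z hz => (hball z hz).2.1)
    hdiff fun z hz => ?_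
  have hzy : |fderiv ℝ ρ z (y - q) - fderiv ℝ ρ y (y - q)| ≤ ‖fderiv ℝ ρ y‖ * ‖y - q‖ :=
    (fderiv ℝ ρ z - fderiv ℝ ρ y).le_of_opNorm_le
      (hosc _ (hball z hz).1 _ (hball y hyR).1).le (y - q)
  linarith [neg_le_of_abs_le hzy]

end NearestBoundaryPoint

theorem norm_add_smul_le_norm_add_smul {𝕜 V : Type*} [RCLike 𝕜] [SeminormedAddCommGroup V]
    [InnerProductSpace 𝕜 V] {w e : V} (hwe : inner 𝕜 w e = 0) {a b : 𝕜} (hab : ‖a‖ ≤ ‖b‖) :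
    ‖w + a • e‖ ≤ ‖w + b • e‖ := by
  have norm_sq (t : 𝕜) : ‖w + t • e‖ ^ 2 = ‖w‖ ^ 2 + (‖t‖ * ‖e‖) ^ 2 := by
    simpa only [← sq, norm_smul] using norm_add_sq_eq_norm_sq_add_norm_sq_of_inner_eq_zero w
      (t • e) (by rw [inner_smul_right, hwe, mul_zero])
  rw [← sq_le_sq₀ (norm_nonneg _) (norm_nonneg _), norm_sq, norm_sq]
  gcongr

section HyperplaneCoord

variable {V : Type*} [NormedAddCommGroup V] [InnerProductSpace ℂ V] {q y z : V}

/-- The affine function `1 - ⟪y - q, z - q⟫ / (2 ‖y - q‖ ^ 2)` of `z`, which equals `1` at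
`q` and for `y ≠ q` vanishes on the complex hyperplane through `2 y - q` orthogonal to `y - q`. -/
noncomputable def hyperplaneCoord (q y z : V) : ℂ :=
  1 - inner ℂ (y - q) (z - q) / ((2 * ‖y - q‖ ^ 2 : ℝ) : ℂ)

theorem hyperplaneCoord_self (q y : V) : hyperplaneCoord q y q = 1 := by simp [hyperplaneCoord]

theorem contDiff_hyperplaneCoord {m : WithTop ℕ∞} (q y : V) :
    ContDiff ℂ m (hyperplaneCoord q y) :=
  contDiff_const.sub
    (((innerSL ℂ (y - q)).contDiff.comp (contDiff_id.sub contDiff_const)).div_const _)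

theorem fderiv_hyperplaneCoord_apply (q y z X : V) : fderiv ℂ (hyperplaneCoord q y) z X =
    -(inner ℂ (y - q) X / ((2 * ‖y - q‖ ^ 2 : ℝ) : ℂ)) := by
  have hinner : HasFDerivAt (fun z => inner ℂ (y - q) (z - q)) (innerSL ℂ (y - q)) z :=
    (innerSL ℂ (y - q)).hasFDerivAt.comp z ((hasFDerivAt_id z).sub_const q)
  have h : fderiv ℂ (hyperplaneCoord q y) z = _ :=
    ((hinner.mul_const ((2 * ‖y - q‖ ^ 2 : ℝ) : ℂ)⁻¹).const_sub 1).fderiv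
  rw [h]
  simp [div_eq_inv_mul]

theorem exists_inner_sub_smul_eq_zero (hy : y ≠ q)
    (hz : hyperplaneCoord q y z ∉ Complex.slitPlane) :
    ∃ m : ℝ, 0 ≤ m ∧ inner ℂ (y - q) (z - q - (m + 2) • (y - q)) = 0 := by
  have he : ((2 * ‖y - q‖ ^ 2 : ℝ) : ℂ) ≠ 0 := by
    simpa using sub_ne_zero.2 hy
  simp only [Complex.mem_slitPlane_iff, not_or, not_lt, not_not] at hz
  have hreal : hyperplaneCoord q y z = ((hyperplaneCoord q y z).re : ℂ) :=
    Complex.ext rfl hz.2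
  set t := (hyperplaneCoord q y z).re
  refine ⟨-2 * t, by linarith [hz.1], ?_⟩
  have hinner : inner ℂ (y - q) (z - q) = (1 - t) * ((2 * ‖y - q‖ ^ 2 : ℝ) : ℂ) := by
    rw [← hreal, hyperplaneCoord, sub_sub_cancel, div_mul_cancel₀ _ he]
  rw [inner_sub_right, ← Complex.coe_smul, inner_smul_right, inner_self_eq_norm_sq_to_K, hinner]
  push_cast
  simp only [Complex.coe_algebraMap]
  ring

end HyperplaneCoord

theorem norm_starProjection_normalLine {n : ℕ} (q y X : CSpace n) :
    ‖(normalLine q y).starProjection X‖ = ‖inner ℂ (y - q) X‖ / ‖y - q‖ := by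
  rw [normalLine, Submodule.starProjection_singleton, norm_smul, norm_div,
    RCLike.norm_ofReal, abs_of_nonneg (by positivity)]
  field_simp

section StarDist

variable {n : ℕ} {D B : Set (CSpace n)} {q y z : CSpace n} {s : ℝ}

theorem sub_reflectedPoint (q y z : CSpace n) :
    z - reflectedPoint q y = z - q - (2 : ℝ) • (y - q) := by
  rw [reflectedPoint, two_smul, two_smul]
  abel

theorem mem_reflectedHyperplane_iff :
    z ∈ reflectedHyperplane q y ↔ inner ℂ (y - q) (z - reflectedPoint q y) = 0 := by
  rw [reflectedHyperplane, mem_ofPred_eq, normalLine,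
    Submodule.mem_orthogonal_singleton_iff_inner_right]

theorem starDist_nonneg (D : Set (CSpace n)) (q y : CSpace n) : 0 ≤ starDist D q y :=
  ENNReal.toReal_nonneg

theorem starDist_le_one (D : Set (CSpace n)) (q y : CSpace n) : starDist D q y ≤ 1 :=
  ENNReal.toReal_le_of_le_ofReal zero_le_one (by simp)

theorem starDist_le_norm_sub (hz : z ∈ closure D ∩ reflectedHyperplane q y) :
    starDist D q y ≤ ‖z - reflectedPoint q y‖ := by
  refine ENNReal.toReal_le_of_le_ofReal (norm_nonneg _) ((min_le_right _ _).trans ?_)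
  rw [← dist_eq_norm, ← edist_dist, edist_comm]
  exact Metric.infEDist_le_edist_of_mem hz

theorem hyperplaneCoord_mem_slitPlane (hs : s ≤ starDist D q y) (hB : Metric.ball q s ⊆ B)
    (hy : y ≠ q) (hD : BackwardInvariantOn D B (y - q)) (hz : z ∈ D ∩ Metric.ball q s) :
    hyperplaneCoord q y z ∈ Complex.slitPlane := by
  by_contra hslit
  obtain ⟨m, hm, hinner⟩ := exists_inner_sub_smul_eq_zero hy hslit
  set w := z - q - (m + 2) • (y - q) with hw
  have norm_lt (a : ℝ) (ha : 0 ≤ a) (ham : a ≤ m + 2) : ‖w + a • (y - q)‖ < s := by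
    have hle := norm_add_smul_le_norm_add_smul (𝕜 := ℂ) (inner_eq_zero_symm.1 hinner)
      (a := a) (b := (m + 2 : ℝ)) (by
        rwa [Complex.norm_of_nonneg ha, Complex.norm_of_nonneg (ha.trans ham)])
    rw [Complex.coe_smul, Complex.coe_smul, hw, sub_add_cancel, ← dist_eq_norm z] at hle
    exact hle.trans_lt hz.2
  have htranslate : z - m • (y - q) - q = w + (2 : ℝ) • (y - q) := by
    rw [hw]; module
  have hmB : z - m • (y - q) ∈ B := hB (by
    rw [Metric.mem_ball, dist_eq_norm, htranslate]
    exact norm_lt 2 zero_le_two (by linarith))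
  have hmD : z - m • (y - q) ∈ D := hD z ⟨hz.1, hB hz.2⟩ m hm hmB
  have hstar : z - m • (y - q) - reflectedPoint q y = w := by
    rw [sub_reflectedPoint, hw]; module
  have hle : starDist D q y ≤ ‖w‖ := hstar ▸ starDist_le_norm_sub ⟨subset_closure hmD, by
    rwa [mem_reflectedHyperplane_iff, hstar]⟩
  have hlt : ‖w‖ < s := by simpa using norm_lt 0 le_rfl (by linarith)
  exact (hs.trans hle).not_gt hlt

end StarDist

theorem norm_fderiv_slitCayley_hyperplaneCoord {n : ℕ} (q y X : CSpace n) :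
    ‖fderiv ℂ (slitCayley ∘ hyperplaneCoord q y) q X‖ =
      ‖(normalLine q y).starProjection X‖ / (8 * ‖y - q‖) := by
  have hcayley : HasDerivAt slitCayley (1 / 4) (hyperplaneCoord q y q) := by
    rw [hyperplaneCoord_self]; exact hasDerivAt_slitCayley_one
  have hcoord : HasFDerivAt (hyperplaneCoord q y) (fderiv ℂ (hyperplaneCoord q y) q) q :=
    (((contDiff_hyperplaneCoord q y).differentiable one_ne_zero) q).hasFDerivAt
  rw [(hcayley.comp_hasFDerivAt q hcoord).fderiv, norm_starProjection_normalLine, smul_apply,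
    fderiv_hyperplaneCoord_apply, norm_smul, norm_neg, norm_div _ (Complex.ofReal _),
    Complex.norm_real, Real.norm_of_nonneg (by positivity)]
  simp only [norm_div, norm_one, RCLike.norm_ofNat]
  ring

theorem ofReal_starDist_div_add_le_sibonyMetric {n : ℕ} {D B : Set (CSpace n)} (hD : IsOpen D)
    {q y : CSpace n} (hq : q ∈ D) (hy : y ≠ q) {R c : ℝ} (hR : ∀ z ∈ D, ‖z - q‖ < R) (hc : 0 < c)
    (hc1 : c ≤ 1) (hcR : c ≤ R) (hB : Metric.ball q c ⊆ B)
    (hDB : BackwardInvariantOn D B (y - q)) (X : CSpace n) :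
    ENNReal.ofReal (c / (64 * R) *
      (starDist D q y / ‖y - q‖ * ‖(normalLine q y).starProjection X‖ + ‖X‖)) ≤
      sibonyMetric D q X := by
  have hR0 : 0 < R := hc.trans_le hcR
  have hX : c / (64 * R) * ‖X‖ ≤ ‖X‖ / (8 * R) := by
    calc c / (64 * R) * ‖X‖ ≤ 8 / (64 * R) * ‖X‖ := by gcongr; linarith
      _ = ‖X‖ / (8 * R) := by field_simp; norm_num
  rcases (starDist_nonneg D q y).eq_or_lt with h0 | h0
  · refine le_trans (ENNReal.ofReal_le_ofReal ?_)
      (ofReal_add_le_sibonyMetric hD hq hR hc hcR (f := 0) contDiffOn_const rfl (by simp) X)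
    simpa [← h0] using hX
  · set s := c * starDist D q y
    have hsc : s ≤ c := mul_le_of_le_one_right hc.le (starDist_le_one D q y)
    have hslit : MapsTo (hyperplaneCoord q y) (D ∩ Metric.ball q s) Complex.slitPlane :=
      fun z hz => hyperplaneCoord_mem_slitPlane (mul_le_of_le_one_left h0.le hc1)
        ((Metric.ball_subset_ball hsc).trans hB) hy hDB hz
    refine le_trans (ENNReal.ofReal_le_ofReal ?_)
      (ofReal_add_le_sibonyMetric hD hq hR (mul_pos hc h0) (hsc.trans hcR)
        (contDiffOn_slitCayley.comp (contDiff_hyperplaneCoord q y).contDiffOn hslit)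
        (by simp only [Function.comp_apply, hyperplaneCoord_self, slitCayley_one])
        (fun z _ => norm_slitCayley_le_one _) X)
    rw [norm_fderiv_slitCayley_hyperplaneCoord, mul_add, add_div]
    refine add_le_add (le_of_eq ?_) hX
    field_simp
    ring

theorem HasC1BoundaryNear.exists_backwardInvariantOn_ball {n : ℕ} {D : Set (CSpace n)}
    {p : CSpace n} (hC1 : HasC1BoundaryNear D p) (hD : IsOpen D) (hp : p ∈ frontier D) :
    ∃ r : ℝ, 0 < r ∧ ∀ q ∈ D ∩ Metric.ball p r, ∀ y ∈ frontier D, ‖q - y‖ = bdryDist D q →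
      BackwardInvariantOn D (Metric.ball p (2 * r)) (y - q) := by
  obtain ⟨U, ρ, hU, hpU, hρ, hne, hDU⟩ := hC1
  have hUp := hU.mem_nhds hpU
  refine exists_backwardInvariantOn_ball_of_contDiffAt hD hp (hρ.contDiffAt hUp) (hne p hpU) ?_
  filter_upwards [hUp] with z hz
  simpa only [mem_inter_iff, mem_ofPred_eq, hz, and_true, true_and] using Set.ext_iff.1 hDU z

theorem proposition7_general (n : ℕ) (D : Set (CSpace n)) (hDo : IsOpen D)
    (hDb : Bornology.IsBounded D) (p : CSpace n) (hp : p ∈ frontier D)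
    (hC1 : HasC1BoundaryNear D p) :
    ∃ c : ℝ, 0 < c ∧ ∀ᶠ q in 𝓝[D] p, ∀ pq ∈ frontier D, ‖q - pq‖ = bdryDist D q →
      ∀ X : CSpace n,
        ENNReal.ofReal (starDist D q pq / bdryDist D q * ‖(normalLine q pq).starProjection X‖ + ‖X‖)
          ≤ ENNReal.ofReal c * sibonyMetric D q X := by
  obtain ⟨r, hr, hinv⟩ := hC1.exists_backwardInvariantOn_ball hDo hp
  set R := Metric.diam D + 1
  have hR1 : 1 ≤ R := le_add_of_nonneg_left Metric.diam_nonneg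
  set c := min 1 r
  have hc : 0 < c := lt_min one_pos hr
  refine ⟨64 * R / c, by positivity, ?_⟩
  filter_upwards [self_mem_nhdsWithin,
    mem_nhdsWithin_of_mem_nhds (Metric.ball_mem_nhds p hr)] with q hq hqr y hy hqy X
  have hyq : y ≠ q := fun h => disjoint_left.1 (disjoint_frontier_iff_isOpen.2 hDo) hy (h ▸ hq)
  have hR (z : CSpace n) (hz : z ∈ D) : ‖z - q‖ < R := by
    rw [← dist_eq_norm]
    exact (Metric.dist_le_diam_of_mem hDb hz hq).trans_lt (lt_add_one _)
  have hball : Metric.ball q c ⊆ Metric.ball p (2 * r) :=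
    Metric.ball_subset_ball' (by linarith [min_le_right 1 r, Metric.mem_ball.1 hqr])
  have hlower := ofReal_starDist_div_add_le_sibonyMetric hDo hq hyq hR hc (min_le_left _ _)
    ((min_le_left _ _).trans hR1) hball (hinv q ⟨hq, hqr⟩ y hy hqy) X
  rw [norm_sub_rev y q, hqy] at hlower
  refine le_of_eq_of_le ?_ (mul_le_mul_right hlower _)
  rw [← ENNReal.ofReal_mul (by positivity), ← mul_assoc, div_mul_div_cancel₀ hc.ne',
    div_self (by positivity), one_mul]

theorem proposition7 (n : ℕ) (D : Set (CSpace n)) (hDo : IsOpen D) (hDc : IsConnected D)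
    (hDb : Bornology.IsBounded D) (p : CSpace n) (hp : p ∈ frontier D)
    (hC1 : HasC1BoundaryNear D p) :
    ∃ c : ℝ, 0 < c ∧ ∀ᶠ q in 𝓝[D] p, ∀ pq ∈ frontier D, ‖q - pq‖ = bdryDist D q →
      ∀ X : CSpace n,
        ENNReal.ofReal (starDist D q pq / bdryDist D q * ‖(normalLine q pq).starProjection X‖ + ‖X‖)
          ≤ ENNReal.ofReal c * sibonyMetric D q X :=
  proposition7_general n D hDo hDb p hp hC1
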